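/- **Setting.** Let $\mathfrak g$ be a finite-dimensional simple complex Lie algebra, $\kappa$ the opposite of its Killing form, $\tau$ an antilinear involutive automorphism of $\mathfrak g$ (defining a real form), $(I_a)$ a basis of $\mathfrak g$ fixed by $\tau$, $(I^a)$ its $\kappa$-dual basis and $C_{12}=\sum_a I_a\otimes I^a$. Let $V$ be the algebra of local fields of a Hamiltonian field theory in one space dimension: a commutative complex algebra with complex conjugation, a derivation $\partial_x$ and a real local Poisson bracket $\{f(x),g(y)\}=\sum_n c_n(x)\,\partial_x^n\delta(x-y)$ (finite sums, $c_n\in V$), i.e. a bilinear, skew-symmetric bracket compatible with $\partial_x$ that obeys the Leibniz rule and the Jacobi identity (a Poisson vertex algebra). Write $\delta=\delta(x-y)$ and $\delta'=\partial_x\delta(x-y)$. Local charges $\int dx\,f(x)$ are elements of $V/\partial_xV$; they act on $V$ by $\{\int f,\cdot\}$. A momentum is a charge $\mathcal P$ with $\{\mathcal P,f\}=\partial_xf$ for all $f\in V$. Let $\Sigma$ be the finite set of sites, formed by real sites, complex sites and the conjugates $\bar\alpha$ of the complex sites ($\bar\alpha=\alpha$ for real $\alpha$), with multiplicities $m_\alpha=m_{\bar\alpha}\ge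 1$, pairwise distinct positions $z_\alpha$ with $z_{\bar\alpha}=\overline{z_\alpha}$, and levels $\ell^\alpha_p$, $0\le p<m_\alpha$, with $\ell^{\bar\alpha}_p=\overline{\ell^\alpha_p}$ and $\ell^\alpha_{m_\alpha-1}\neq0$; let $\ell^\infty\in\mathbb R\setminus\{0\}$. Suppose that $V$ realises the corresponding Takiff currents: there are $\mathfrak g$-valued fields $J^\alpha_p$, $0\le p<m_\alpha$, with $\tau(J^\alpha_p)=J^{\bar\alpha}_p$ and $$\{J^\alpha_{p\,1}(x),J^\beta_{q\,2}(y)\}=\delta_{\alpha\beta}\bigl([C_{12},J^\alpha_{p+q\,1}(x)]\,\delta-\ell^\alpha_{p+q}\,C_{12}\,\delta'\bigr)\ \text{ if } p+q<m_\alpha,\qquad 0\ \text{ if } p+q\ge m_\alpha .$$ Let $\eta^\alpha_p$, $0\le p\le 2m_\alpha-2$, be the solution of $\sum_{p=0}^{m_\alpha-1-r}\eta^\alpha_{p+q}\ell^\alpha_{p+r}=\delta_{qr}$ ($0\le q,r\le m_\alpha-1$). Suppose that the realisation is suitable, i.e. that a momentum $\mathcal P$ of the theory is $$\mathcal P=\sum_{\alpha\in\Sigma}\frac12\sum_{q,r=0}^{m_\alpha-1}\eta^\alpha_{q+r}\int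 dx\,\kappa\bigl(J^\alpha_q(x),J^\alpha_r(x)\bigr).$$ Put $\Gamma(z,x)=\sum_{\alpha}\sum_{p<m_\alpha}\frac{J^\alpha_p(x)}{(z-z_\alpha)^{p+1}}$ and $\varphi(z)=\sum_\alpha\sum_{p<m_\alpha}\frac{\ell^\alpha_p}{(z-z_\alpha)^{p+1}}-\ell^\infty$. Suppose that the zeros $\zeta_1,\dots,\zeta_M$ of $\varphi$, $M=\sum_\alpha m_\alpha$, are simple. Define $$q_i(x)=-\frac1{2\varphi'(\zeta_i)}\kappa\bigl(\Gamma(\zeta_i,x),\Gamma(\zeta_i,x)\bigr),\qquad \mathcal Q_i=\int dx\,q_i(x),\qquad \mathcal H=\sum_{i=1}^M\epsilon_i\mathcal Q_i ,$$ with $\epsilon_1,\dots,\epsilon_M\in\mathbb C$, and let $\partial_0=\partial_t=\{\mathcal H,\cdot\}$, $\partial_1=\partial_x=\{\mathcal P,\cdot\}$. An energy-momentum tensor is a family $T^\mu{}_\nu\in V$ ($\mu,\nu\in\{0,1\}$) with $\mathcal H=\int dx\,T^0{}_0$, $\mathcal P=\int dx\,T^0{}_1$ and $\sum_\mu\partial_\mu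 T^\mu{}_\nu=0$ for $\nu=0,1$. Put $T_{\mu\nu}=\eta_{\mu\rho}T^\rho{}_\nu$ with $\eta=\mathrm{diag}(1,-1)$. The model is called Lorentz invariant if there is a density $b\in V$ of $\mathcal H$ such that the boosts $\delta f=\{t\mathcal P+\int dx\,x\,b(x),f\}=t\,\partial_xf+x\,\partial_tf+Sf$, where $S$ is the resulting derivation of $V$, preserve the dynamics, i.e. $[\partial_t,\partial_x]=0$, $[S,\partial_x]=\partial_t$ and $[S,\partial_t]=\partial_x$ on $V$. **Proposition.** 1. $\{q_i(x),q_j(y)\}=-\delta_{ij}\bigl(\partial_xq_i(x)\,\delta+2q_i(x)\,\delta'\bigr)$ for all $i,j$. 2. The fields $$T^0{}_1=\sum_iq_i,\qquad T^0{}_0=-T^1{}_1=\sum_i\epsilon_iq_i,\qquad T^1{}_0=-\sum_i\epsilon_i^2q_i$$ form an energy-momentum tensor of the model, and for these densities $T^0{}_\nu$ the components $T^1{}_\nu$ are unique up to addition of fields annihilated by $\partial_x$. 3. This tensor is traceless: $T^0{}_0+T^1{}_1=0$. 4. If $\epsilon_i=\pm1$ for every $i$, then $T_{\mu\nu}=T_{\nu\mu}$.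 If $T_{\mu\nu}=T_{\nu\mu}$, then the model is Lorentz invariant. In particular it is Lorentz invariant if $\epsilon_i=\pm1$ for every $i$. -/

import Mathlib

open scoped TensorProduct

noncomputable section

namespace AffineGaudin

/-! ## Local observables of a Hamiltonian field theory in one space dimension

The local fields evaluated at a space point form a commutative algebra `V` with the derivation
`∂ = ∂_x`, with complex conjugation `star`, and with a local Poisson bracket, that is a bracket
`{f(x), g(y)}` which is a finite sum of fields times derivatives of the Dirac distribution. -/

/-- A Poisson algebra of local fields (a Poisson vertex algebra, with conjugation).
The bracket of two fields is encoded by its products `f_(n) g = prod n f g`: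
`{f(x), g(y)} = ∑ n, (1 / n!) (f_(n) g)(y) ∂_y^n δ(x - y)`.
In terms of the generating function `{f_λ g} = ∑ n, (λ^n / n!) f_(n) g`, the fields of the structure
are locality, sesquilinearity, skew-symmetry, the Jacobi identity, the Leibniz rule, and reality. -/
structure FieldAlgebra (V : Type*) [CommRing V] [Algebra ℂ V] [StarRing V] where
  /-- the space derivative `∂_x` -/
  D : Derivation ℂ V V
  /-- the products `f_(n) g` -/
  prod : ℕ → V →ₗ[ℂ] V →ₗ[ℂ] V
  locality : ∀ f g : V, ∃ N : ℕ, ∀ n, N ≤ n → prod n f g = 0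
  deriv_left : ∀ (n : ℕ) (f g : V), prod n (D f) g = -((n : ℂ) • prod (n - 1) f g)
  deriv_right : ∀ (n : ℕ) (f g : V),
    prod n f (D g) = D (prod n f g) + (n : ℂ) • prod (n - 1) f g
  skew : ∀ (f g : V) (N : ℕ), (∀ n, N ≤ n → prod n g f = 0) → ∀ n : ℕ,
    prod n f g = -∑ k ∈ Finset.range N,
      ((-1 : ℂ) ^ (n + k) / (k.factorial : ℂ)) • (D^[k]) (prod (n + k) g f)
  jacobi : ∀ (m n : ℕ) (f g h : V),
    prod m f (prod n g h) - prod n g (prod m f h) =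
      ∑ k ∈ Finset.range (m + 1), (m.choose k : ℂ) • prod (m + n - k) (prod k f g) h
  leibniz : ∀ (n : ℕ) (f g h : V), prod n f (g * h) = prod n f g * h + g * prod n f h
  star_D : ∀ f : V, star (D f) = D (star f)
  star_prod : ∀ (n : ℕ) (f g : V), star (prod n f g) = prod n (star f) (star g)

namespace FieldAlgebra

variable {V : Type*} [CommRing V] [Algebra ℂ V] [StarRing V] (A : FieldAlgebra V)

/-- `coeff n f g` is the field `c_n` in the expansion
`{f(x), g(y)} = ∑ n, c_n(x) δ^(n)(x - y)`, where `δ^(n)(x - y) = ∂_x^n δ(x - y)`. It is read off from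
`{f(x), g(y)} = -{g(y), f(x)}`. -/
def coeff (n : ℕ) : V →ₗ[ℂ] V →ₗ[ℂ] V :=
  (-(1 / (n.factorial : ℂ))) • (A.prod n).flip

/-- Local charges: densities modulo total space derivatives. -/
abbrev Charge : Type _ := V ⧸ LinearMap.range (A.D : V →ₗ[ℂ] V)

/-- The local charge `∫ dx f(x)` with density `f`. -/
def integral : V →ₗ[ℂ] A.Charge := (LinearMap.range (A.D : V →ₗ[ℂ] V)).mkQ

/-- The operator `f_(n)` on local fields, which is a derivation. For `n = 0` and `n = 1` one has
`{∫ dx f(x), g(y)} = (f_(0) g)(y)` and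
`{∫ dx x f(x), g(y)} = y (f_(0) g)(y) + (f_(1) g)(y)`. -/
def mode (n : ℕ) (f : V) : Derivation ℂ V V :=
  Derivation.mk' (A.prod n f) (fun g h => by
    rw [A.leibniz, smul_eq_mul, smul_eq_mul]; ring)

/-- The flow `{Q, ·}` of a local charge `Q` on the local fields. -/
def flow : A.Charge →ₗ[ℂ] Derivation ℂ V V :=
  (LinearMap.range (A.D : V →ₗ[ℂ] V)).liftQ
    { toFun := A.mode 0
      map_add' := fun f g => by ext h; simp [mode]
      map_smul' := fun c f => by ext h; simp [mode] }
    (by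
      rintro _ ⟨f, rfl⟩
      rw [LinearMap.mem_ker]
      ext h
      simp [mode, A.deriv_left])

/-- `P` is the momentum of the field theory: its flow is the space derivative. -/
def IsMomentum (P : A.Charge) : Prop := ∀ f : V, A.flow P f = A.D f

/-- The space-time derivatives `∂_0 = ∂_t = {H, ·}` and `∂_1 = ∂_x = {P, ·}`. -/
def spaceTimeDeriv (H P : A.Charge) : Fin 2 → Derivation ℂ V V := ![A.flow H, A.flow P]

/-- `T μ ν`, standing for `T^μ_ν(x)`, is an energy-momentum tensor of the model with Hamiltonian `H`
and momentum `P`: `T^0_0` and `T^0_1` are densities of `H` and `P`, and the components `T^1_ν`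
satisfy the local conservation equations `∂_μ T^μ_ν = 0`. -/
structure IsEnergyMomentumTensor (H P : A.Charge) (T : Fin 2 → Fin 2 → V) : Prop where
  hamiltonian : A.integral (T 0 0) = H
  momentum : A.integral (T 0 1) = P
  conservation : ∀ ν : Fin 2, ∑ μ : Fin 2, A.spaceTimeDeriv H P μ (T μ ν) = 0

/-- Lorentz invariance of the model with Hamiltonian `H` and momentum `P`: the Poincaré algebra in
two dimensions acts on the local fields by canonical transformations, the translations being
`∂_t = {H, ·}` and `∂_x = {P, ·}`, and the boost being generated by `B = t P + ∫ dx x b(x)` for some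
density `b` of `H`. Thus `δf = {B, f} = t ∂_x f + x ∂_t f + S f`, where the operator `S = b_(1)`
acts on internal (spin) degrees of freedom, and the three commutation relations say that `δ`
commutes with the total derivatives in `t` and `x`, so that boosts preserve the dynamics. -/
def IsLorentzInvariant (H P : A.Charge) : Prop :=
  ∃ b : V, A.integral b = H ∧
    ⁅A.flow H, A.flow P⁆ = 0 ∧
    ⁅A.mode 1 b, A.flow P⁆ = A.flow H ∧
    ⁅A.mode 1 b, A.flow H⁆ = A.flow P

end FieldAlgebra

/-- The Minkowski metric `diag(+1, -1)`. -/
def minkowski : Matrix (Fin 2) (Fin 2) ℂ := Matrix.diagonal ![1, -1]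

/-- Lowering the first index: `T_{μν} = η_{μρ} T^ρ_ν`. -/
def lowerIndex {V : Type*} [AddCommGroup V] [Module ℂ V] (T : Fin 2 → Fin 2 → V) :
    Fin 2 → Fin 2 → V :=
  fun μ ν => ∑ ρ : Fin 2, minkowski μ ρ • T ρ ν

/-! ## Lie-algebraic data -/

section Lie

variable (𝔤 : Type*) [LieRing 𝔤] [LieAlgebra ℂ 𝔤]

/-- The opposite of the Killing form. -/
def kappa : LinearMap.BilinForm ℂ 𝔤 := -killingForm ℂ 𝔤

/-- An antilinear involutive automorphism; its fixed points form a real form of `𝔤`. -/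
structure RealForm where
  τ : 𝔤 →ₛₗ[starRingEnd ℂ] 𝔤
  involutive : ∀ X : 𝔤, τ (τ X) = X
  map_lie : ∀ X Y : 𝔤, τ ⁅X, Y⁆ = ⁅τ X, τ Y⁆

/-- A basis `I_a` of `𝔤` contained in the real form, with its dual basis `I^a` for `κ`. -/
structure DualBases (R : RealForm 𝔤) (ι : Type*) [DecidableEq ι] where
  I : Module.Basis ι ℂ 𝔤
  real : ∀ a : ι, R.τ (I a) = I a
  dual : ι → 𝔤
  kappa_dual : ∀ a b : ι, kappa 𝔤 (I a) (dual b) = if a = b then 1 else 0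

variable {𝔤} {V : Type*} [CommRing V] [Algebra ℂ V]

/-- The form `κ` extended `V`-bilinearly to `𝔤`-valued fields. -/
def kappaField : LinearMap.BilinForm V (V ⊗[ℂ] 𝔤) := (kappa 𝔤).baseChange V

variable {R : RealForm 𝔤} {ι : Type*} [Fintype ι] [DecidableEq ι] (B : DualBases 𝔤 R ι)

/-- The split quadratic Casimir `C_12 = I_a ⊗ I^a`. -/
def casimir : 𝔤 ⊗[ℂ] 𝔤 := ∑ a : ι, B.I a ⊗ₜ[ℂ] B.dual a

/-- `[C_12, J_1] = [I_a, J] ⊗ I^a` for a `𝔤`-valued field `J`. -/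
def casimirBracket (J : V ⊗[ℂ] 𝔤) : V ⊗[ℂ] (𝔤 ⊗[ℂ] 𝔤) :=
  ∑ a : ι, LinearMap.lTensor V
    ((TensorProduct.mk ℂ 𝔤 𝔤).flip (B.dual a) ∘ₗ (LieAlgebra.ad ℂ 𝔤 (B.I a) : 𝔤 →ₗ[ℂ] 𝔤)) J

/-- The coefficient `c_n` in `{J_1(x), K_2(y)} = ∑ n, c_n(x) δ^(n)(x - y)`, for `𝔤`-valued fields
`J` and `K`. -/
def FieldAlgebra.tensorCoeff [StarRing V] (A : FieldAlgebra V) (n : ℕ) (J K : V ⊗[ℂ] 𝔤) :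
    V ⊗[ℂ] (𝔤 ⊗[ℂ] 𝔤) :=
  TensorProduct.map₂ (A.coeff n) (TensorProduct.mk ℂ 𝔤 𝔤) J K

/-- The action of `τ` on `𝔤`-valued fields, `f ⊗ X ↦ star f ⊗ τ X`. -/
def RealForm.conj (R : RealForm 𝔤) [StarRing V] [StarModule ℂ V] :
    V ⊗[ℂ] 𝔤 →ₛₗ[starRingEnd ℂ] V ⊗[ℂ] 𝔤 :=
  TensorProduct.map ((starLinearEquiv ℂ : V ≃ₗ⋆[ℂ] V) : V →ₗ⋆[ℂ] V) R.τ

end Lie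

/-! ## Affine Gaudin models -/

/-- The sites: real sites, complex sites, and the conjugates of the complex sites. -/
abbrev Site (Sr Sc : Type*) : Type _ := Sr ⊕ (Sc ⊕ Sc)

/-- The parameters of a local affine Gaudin model: multiplicities `m_α`, levels `ℓ^α_p` for `p < m_α`
(values for other `p` play no role), positions `z_α`, and the constant term `ℓ^∞` of the twist
function. -/
structure GaudinData (Sr Sc : Type*) where
  multR : Sr → ℕ
  multC : Sc → ℕ
  multR_pos : ∀ s, 0 < multR s
  multC_pos : ∀ s, 0 < multC s
  levelR : Sr → ℕ → ℝ
  levelC : Sc → ℕ → ℂ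
  levelR_top : ∀ s, levelR s (multR s - 1) ≠ 0
  levelC_top : ∀ s, levelC s (multC s - 1) ≠ 0
  posR : Sr → ℝ
  posC : Sc → ℂ
  levelInf : ℝ
  levelInf_ne : levelInf ≠ 0

/-- The conjugation of sites. -/
def conjSite {Sr Sc : Type*} : Site Sr Sc → Site Sr Sc
  | Sum.inl s => Sum.inl s
  | Sum.inr (Sum.inl s) => Sum.inr (Sum.inr s)
  | Sum.inr (Sum.inr s) => Sum.inr (Sum.inl s)

namespace GaudinData

variable {Sr Sc : Type*} (G : GaudinData Sr Sc)

/-- The multiplicity `m_α`. -/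
def mult : Site Sr Sc → ℕ
  | Sum.inl s => G.multR s
  | Sum.inr (Sum.inl s) => G.multC s
  | Sum.inr (Sum.inr s) => G.multC s

/-- The level `ℓ^α_p`. -/
def level : Site Sr Sc → ℕ → ℂ
  | Sum.inl s, p => (G.levelR s p : ℂ)
  | Sum.inr (Sum.inl s), p => G.levelC s p
  | Sum.inr (Sum.inr s), p => (starRingEnd ℂ) (G.levelC s p)

/-- The position `z_α`. -/
def pos : Site Sr Sc → ℂ
  | Sum.inl s => (G.posR s : ℂ)
  | Sum.inr (Sum.inl s) => G.posC s
  | Sum.inr (Sum.inr s) => (starRingEnd ℂ) (G.posC s)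

/-- The numbers `η^α_p`, `0 ≤ p ≤ 2 m_α - 2`, dual to the levels:
`∑_{p = 0}^{m_α - 1 - r} η^α_{p + q} ℓ^α_{p + r} = δ_{qr}` for `0 ≤ q, r ≤ m_α - 1`. -/
def IsDualLevels (η : Site Sr Sc → ℕ → ℂ) : Prop :=
  ∀ (α : Site Sr Sc) (q r : ℕ), q < G.mult α → r < G.mult α →
    ∑ p ∈ Finset.range (G.mult α - r), η α (p + q) * G.level α (p + r) = if q = r then 1 else 0

variable [Fintype Sr] [Fintype Sc]

/-- The twist function `φ(z)`. -/
def twist (z : ℂ) : ℂ :=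
  (∑ α : Site Sr Sc, ∑ p ∈ Finset.range (G.mult α), G.level α p / (z - G.pos α) ^ (p + 1))
    - (G.levelInf : ℂ)

/-- `M`, the sum of the multiplicities. -/
def numZeros : ℕ := ∑ α : Site Sr Sc, G.mult α

/-- `ζ` enumerates the zeros of the twist function, and these are simple. -/
structure IsSimpleZeros (ζ : Fin G.numZeros → ℂ) : Prop where
  injective : Function.Injective ζ
  mem_iff : ∀ z : ℂ, (∃ i, ζ i = z) ↔ (∀ α : Site Sr Sc, z ≠ G.pos α) ∧ G.twist z = 0
  simple : ∀ i, deriv G.twist (ζ i) ≠ 0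

variable {𝔤 : Type*} [LieRing 𝔤] [LieAlgebra ℂ 𝔤] {V : Type*} [CommRing V] [Algebra ℂ V]

/-- The Gaudin Lax matrix `Γ(z, x)`. -/
def lax (J : Site Sr Sc → ℕ → V ⊗[ℂ] 𝔤) (z : ℂ) : V ⊗[ℂ] 𝔤 :=
  ∑ α : Site Sr Sc, ∑ p ∈ Finset.range (G.mult α), (1 / (z - G.pos α) ^ (p + 1)) • J α p

/-- The field `-(1 / (2 φ'(w))) κ(Γ(w, x), Γ(w, x))`; at a zero `w = ζ_i` of the twist function this is
the density `q_i(x)` of the quadratic charge `Q_i`. -/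
def chargeDensity (J : Site Sr Sc → ℕ → V ⊗[ℂ] 𝔤) (w : ℂ) : V :=
  (-(1 / (2 * deriv G.twist w))) • kappaField (G.lax J w) (G.lax J w)

/-- The density of the generalised Segal-Sugawara integral `D^α_p`. -/
def segalSugawara (η : Site Sr Sc → ℕ → ℂ) (J : Site Sr Sc → ℕ → V ⊗[ℂ] 𝔤)
    (α : Site Sr Sc) (p : ℕ) : V :=
  (1 / 2 : ℂ) • ∑ q ∈ Finset.range (G.mult α), ∑ r ∈ Finset.range (G.mult α),
    if p ≤ q + r then η α (q + r - p) • kappaField (J α q) (J α r) else 0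

section Realisation

variable [StarRing V] [StarModule ℂ V] {R : RealForm 𝔤} {ι : Type*} [Fintype ι] [DecidableEq ι]

open Classical in
/-- The `𝔤`-valued fields `J^α_p` (`p < m_α`) form a realisation of the Takiff currents in the field
theory `A`: with `δ = δ(x - y)` and `δ' = ∂_x δ(x - y)`,
`{J^α_p 1(x), J^β_q 2(y)} = δ_{αβ} ([C_12, J^α_{p+q} 1(x)] δ - ℓ^α_{p+q} C_12 δ')` if `p + q < m_α`
and `0` if `p + q ≥ m_α`; moreover the currents obey the reality conditions. -/
structure IsRealisation (A : FieldAlgebra V) (B : DualBases 𝔤 R ι)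
    (J : Site Sr Sc → ℕ → V ⊗[ℂ] 𝔤) : Prop where
  bracket_zero : ∀ (α β : Site Sr Sc) (p q : ℕ), p < G.mult α → q < G.mult β →
    A.tensorCoeff 0 (J α p) (J β q) =
      if α = β ∧ p + q < G.mult α then casimirBracket B (J α (p + q)) else 0
  bracket_one : ∀ (α β : Site Sr Sc) (p q : ℕ), p < G.mult α → q < G.mult β →
    A.tensorCoeff 1 (J α p) (J β q) =
      if α = β ∧ p + q < G.mult α then -(G.level α (p + q) • ((1 : V) ⊗ₜ[ℂ] casimir B)) else 0
  bracket_high : ∀ (α β : Site Sr Sc) (p q n : ℕ), p < G.mult α → q < G.mult β → 2 ≤ n →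
    A.tensorCoeff n (J α p) (J β q) = 0
  reality : ∀ (α : Site Sr Sc) (p : ℕ), p < G.mult α → R.conj (J α p) = J (conjSite α) p

/-- The realisation is suitable: the momentum `P` of the field theory is the image of the momentum
`∑_α D^α_0` of the Gaudin model. -/
def IsSuitable (A : FieldAlgebra V) (η : Site Sr Sc → ℕ → ℂ) (J : Site Sr Sc → ℕ → V ⊗[ℂ] 𝔤)
    (P : A.Charge) : Prop :=
  ∑ α : Site Sr Sc, A.integral (G.segalSugawara η J α 0) = P

/-- The quadratic charge `Q_i = ∫ dx q_i(x)`. -/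
def charge (A : FieldAlgebra V) (J : Site Sr Sc → ℕ → V ⊗[ℂ] 𝔤) (w : ℂ) : A.Charge :=
  A.integral (G.chargeDensity J w)

/-- The Hamiltonian `H = ∑_i ε_i Q_i`. -/
def hamiltonian (A : FieldAlgebra V) (J : Site Sr Sc → ℕ → V ⊗[ℂ] 𝔤)
    (ζ ε : Fin G.numZeros → ℂ) : A.Charge :=
  ∑ i, ε i • G.charge A J (ζ i)

end Realisation

end GaudinData

end AffineGaudin

end

open scoped TensorProduct

noncomputable section

namespace AffineGaudin

/-! ### Skew-symmetry for brackets of order at most one -/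

namespace FieldAlgebra

variable {V : Type*} [CommRing V] [Algebra ℂ V] [StarRing V] (A : FieldAlgebra V)

/-! Everything rests on the partial fraction identity `smul_polarPair`. It gives the bracket of
`Γ(w)` with `Γ(z)` a `δ` part built from `L`, where `(w - z) L = Γ(z) - Γ(w)`, and a `δ'` part with
coefficient `-s`, where `(w - z) s = φ(z) - φ(w)`. In the bracket of `κ(Γ(w), Γ(w))` with `κ(Γ(z),
Γ(z))` the first part contributes `κ(Γ(w), [Γ(z), L])`, which vanishes by invariance of `κ`, and the
second is proportional to `s`. At distinct zeros of `φ` one has `s = 0`, so the densities commute;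
at `w = z` one has `s = -φ'(w)`, and the normalisation of `q_i` gives `prod_chargeDensity_self`.

The momentum comes from the same pairing: on the zeros, the matrix of levels becomes diagonal with
entries `-φ'(ζ_i)`. The change of basis is square, so inverting it expresses the `η^α_(p+q)` through
the zeros, and `∑ q_i` equals the Segal-Sugawara density of `P` exactly.

Hence `∑ ε_i q_i` and `∑ ε'_i q_i` have brackets governed by `ε_i ε'_i`, which yields the
conservation laws. Symmetry of the tensor says `∑ ε_i² q_i = ∑ q_i`; then `b = T^0_0` satisfies
`b_(0) b = ∂p` and `b_(1) b = 2p` with `p = T^0_1`, and the Jacobi identity closes the Poincaré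
algebra. -/

theorem prod_zero_eq_of_order_le_one {f g : V} (h : ∀ n, 2 ≤ n → A.prod n g f = 0) :
    A.prod 0 f g = A.D (A.prod 1 g f) - A.prod 0 g f := by
  rw [A.skew f g 2 h 0]
  simp [Finset.sum_range_succ, sub_eq_add_neg]

theorem prod_one_eq_of_order_le_one {f g : V} (h : ∀ n, 2 ≤ n → A.prod n g f = 0) :
    A.prod 1 f g = A.prod 1 g f := by
  rw [A.skew f g 2 h 1]
  simp [Finset.sum_range_succ, h 2 le_rfl]

theorem prod_eq_zero_of_order_le_one {f g : V} (h : ∀ n, 2 ≤ n → A.prod n g f = 0)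
    {n : ℕ} (hn : 2 ≤ n) : A.prod n f g = 0 := by
  rw [A.skew f g 2 h n]
  simp [Finset.sum_range_succ, h n hn, h (n + 1) (by omega)]

theorem prod_eq_smul_coeff (n : ℕ) (f g : V) :
    A.prod n g f = -(n.factorial : ℂ) • A.coeff n f g := by
  have : (n.factorial : ℂ) ≠ 0 := by exact_mod_cast n.factorial_ne_zero
  simp [coeff, smul_smul, this]

end FieldAlgebra

/-! ### Brackets of quadratic fields -/

section Quadratic

variable {V : Type*} [CommRing V] [Algebra ℂ V] {ι : Type*} [Fintype ι]

/-- The quadratic field `∑ κ_ab u_a u_b`. -/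
def quad (k : ι → ι → ℂ) (u : ι → V) : V := ∑ a, ∑ b, k a b • (u a * u b)

theorem Derivation.map_quad (d : Derivation ℂ V V) {k : ι → ι → ℂ} (hk : ∀ a b, k a b = k b a)
    (u : ι → V) : d (quad k u) = (2 : ℂ) • ∑ a, ∑ b, k a b • (u a * d (u b)) := by
  simp only [quad, map_sum, Derivation.map_smul, Derivation.leibniz, smul_eq_mul, smul_add,
    Finset.sum_add_distrib]
  rw [two_smul]
  congr 1
  rw [Finset.sum_comm]
  exact Finset.sum_congr rfl fun a _ => Finset.sum_congr rfl fun b _ => by rw [hk]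

/-- The form `k` produced by the Leibniz rule cancels the inverse form `m` carried by the brackets
of the components. -/
theorem sum_sum_smul_mul_dual [DecidableEq ι] {k m : ι → ι → ℂ}
    (hm : ∀ a c, ∑ b, k a b * m c b = if a = c then 1 else 0) (v z : ι → V) :
    ∑ a, ∑ b, k a b • (v a * ∑ c, m c b • z c) = ∑ c, v c * z c := by
  refine Finset.sum_congr rfl fun a _ => ?_
  have : ∀ b, k a b • (v a * ∑ c, m c b • z c) = ∑ c, (k a b * m c b) • (v a * z c) := by
    intro b
    rw [Finset.mul_sum, Finset.smul_sum]
    exact Finset.sum_congr rfl fun c _ => by rw [mul_smul_comm, smul_smul]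
  simp only [this]
  rw [Finset.sum_comm]
  simp only [← Finset.sum_smul, hm]
  simp

theorem sum_sum_eq_zero_of_antisymm {x : ι → ι → V} (hx : ∀ a b, x a b = -x b a) :
    ∑ a, ∑ b, x a b = 0 := by
  have h : ∑ a, ∑ b, x a b = -∑ a, ∑ b, x a b := by
    conv_lhs => rw [Finset.sum_comm]
    simp only [← Finset.sum_neg_distrib]
    exact Finset.sum_congr rfl fun a _ => Finset.sum_congr rfl fun b _ => hx b a
  have h2 : (2 : ℂ) • ∑ a, ∑ b, x a b = 0 := by
    rw [two_smul]; nth_rewrite 1 [h]; simp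
  exact (smul_eq_zero_iff_right (two_ne_zero (α := ℂ))).mp h2

variable [StarRing V] (A : FieldAlgebra V) [DecidableEq ι]

/-- The bracket of two quadratic fields `κ(u, u)` and `κ(v, v)` when the bracket of `v` with `u` is
at most of first order, its first order part being a multiple of the inverse `m` of `κ`. -/
theorem prod_quad_quad {k m : ι → ι → ℂ} (hk : ∀ a b, k a b = k b a)
    (hm : ∀ a c, ∑ b, k a b * m c b = if a = c then 1 else 0)
    {u v : ι → V} {t : ι → ι → V} {s : ℂ}
    (h0 : ∀ a b, A.prod 0 (v b) (u a) = ∑ c, m c b • t c a)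
    (h1 : ∀ a b, A.prod 1 (v b) (u a) = (s * m a b) • 1)
    (h2 : ∀ n, 2 ≤ n → ∀ a b, A.prod n (v b) (u a) = 0) :
    A.prod 0 (quad k u) (quad k v) =
      (4 : ℂ) • (s • (∑ c, ∑ e, k c e • (v c * A.D (u e)))
        - ∑ c, ∑ e, v c * u e * ∑ a, k e a • t c a) ∧
    A.prod 1 (quad k u) (quad k v) = (4 * s) • ∑ c, ∑ e, k c e • (v c * u e) ∧
    ∀ n, 2 ≤ n → A.prod n (quad k u) (quad k v) = 0 := by
  have hq : ∀ n f (w : ι → V), A.prod n f (quad k w)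
      = (2 : ℂ) • ∑ a, ∑ b, k a b • (w a * A.prod n f (w b)) := fun n f w =>
    Derivation.map_quad (A.mode n f) hk w
  -- The Leibniz rule holds in the right argument only: `quad k u` is expanded there first (`e0`,
  -- `e1`, `e2`), skew-symmetry moves it to the left (`f0`, `f1`), and `quad k v` is expanded last.
  have e2 : ∀ b n, 2 ≤ n → A.prod n (v b) (quad k u) = 0 := by
    intro b n hn
    simp [hq, h2 n hn]
  have e1 : ∀ b, A.prod 1 (v b) (quad k u)
      = ∑ c, m c b • ((2 * s) • ∑ e, k c e • u e) := by
    intro b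
    rw [hq, Finset.sum_comm, Finset.smul_sum]
    refine Finset.sum_congr rfl fun c _ => ?_
    simp only [h1, Finset.smul_sum, smul_smul, mul_smul_comm, mul_one]
    refine Finset.sum_congr rfl fun e _ => ?_
    rw [hk e c]; congr 1; ring
  have e0 : ∀ b, A.prod 0 (v b) (quad k u)
      = ∑ c, m c b • ((2 : ℂ) • ∑ e, u e * ∑ a, k e a • t c a) := by
    intro b
    rw [hq]
    simp only [h0, Finset.smul_sum, Finset.mul_sum]
    have : ∀ x y : ι, ∑ i, (2 : ℂ) • k x y • (u x * m i b • t i y)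
        = ∑ i, m i b • (2 : ℂ) • (u x * k x y • t i y) := by
      intro x y
      refine Finset.sum_congr rfl fun i _ => ?_
      simp only [mul_smul_comm, smul_smul]
      congr 1; ring
    simp only [this]
    rw [Finset.sum_congr rfl fun x _ => Finset.sum_comm, Finset.sum_comm]
  have f0 : ∀ b, A.prod 0 (quad k u) (v b) = ∑ c, m c b •
      ((2 * s) • (∑ e, k c e • A.D (u e)) - (2 : ℂ) • ∑ e, u e * ∑ a, k e a • t c a) := by
    intro b
    rw [A.prod_zero_eq_of_order_le_one (e2 b), e0, e1]
    simp only [map_sum, Derivation.map_smul, smul_sub, Finset.sum_sub_distrib]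
  have f1 : ∀ b, A.prod 1 (quad k u) (v b) = ∑ c, m c b • ((2 * s) • ∑ e, k c e • u e) := by
    intro b
    rw [A.prod_one_eq_of_order_le_one (e2 b), e1]
  refine ⟨?_, ?_, fun n hn => ?_⟩
  · rw [hq]
    simp only [f0]
    rw [sum_sum_smul_mul_dual hm]
    simp only [mul_sub, Finset.sum_sub_distrib, smul_sub, Finset.mul_sum, Finset.smul_sum,
      mul_smul_comm, smul_smul, mul_assoc]
    congr 1
    · refine Finset.sum_congr rfl fun c _ => Finset.sum_congr rfl fun e _ => ?_
      congr 1; ring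
    · refine Finset.sum_congr rfl fun c _ => Finset.sum_congr rfl fun e _ =>
        Finset.sum_congr rfl fun a _ => ?_
      congr 1; ring
  · rw [hq]
    simp only [f1]
    rw [sum_sum_smul_mul_dual hm]
    simp only [Finset.mul_sum, Finset.smul_sum, mul_smul_comm, smul_smul]
    refine Finset.sum_congr rfl fun c _ => Finset.sum_congr rfl fun e _ => ?_
    congr 1; ring
  · rw [hq]
    simp [A.prod_eq_zero_of_order_le_one (e2 _) hn]

end Quadratic

/-! ### Components of `𝔤`-valued fields -/

section Contraction

variable {V : Type*} [CommRing V] [Algebra ℂ V] {E : Type*} [AddCommGroup E] [Module ℂ E]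

/-- A linear form on `E` applied to an `E`-valued field. -/
def contract (ξ : E →ₗ[ℂ] ℂ) : V ⊗[ℂ] E →ₗ[ℂ] V :=
  (TensorProduct.rid ℂ V).toLinearMap ∘ₗ ξ.lTensor V

@[simp]
theorem contract_tmul (ξ : E →ₗ[ℂ] ℂ) (f : V) (X : E) : contract ξ (f ⊗ₜ[ℂ] X) = ξ X • f := by
  simp [contract]

theorem contract_lTensor {E' : Type*} [AddCommGroup E'] [Module ℂ E'] (ξ : E →ₗ[ℂ] ℂ)
    (f : E' →ₗ[ℂ] E) (J : V ⊗[ℂ] E') : contract ξ (f.lTensor V J) = contract (ξ ∘ₗ f) J := by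
  induction J with
  | zero => simp
  | tmul => simp
  | add x y hx hy => simp [hx, hy]

variable {ι : Type*} [Fintype ι]

theorem sum_contract_coord_tmul (b : Module.Basis ι ℂ E) (J : V ⊗[ℂ] E) :
    ∑ a, contract (b.coord a) J ⊗ₜ[ℂ] b a = J := by
  induction J with
  | zero => simp
  | tmul f X =>
    simp only [contract_tmul, TensorProduct.smul_tmul, ← TensorProduct.tmul_sum]
    simp [b.sum_repr]
  | add x y hx hy => simp only [map_add, TensorProduct.add_tmul, Finset.sum_add_distrib, hx, hy]

theorem contract_eq_sum (b : Module.Basis ι ℂ E) (ξ : E →ₗ[ℂ] ℂ) (J : V ⊗[ℂ] E) :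
    contract ξ J = ∑ a, ξ (b a) • contract (b.coord a) J := by
  conv_lhs => rw [← sum_contract_coord_tmul b J]
  simp only [map_sum, contract_tmul]

variable {𝔤 : Type*} [LieRing 𝔤] [LieAlgebra ℂ 𝔤]

theorem kappaField_self_eq_quad (b : Module.Basis ι ℂ 𝔤) (J : V ⊗[ℂ] 𝔤) :
    kappaField J J = quad (fun a c => kappa 𝔤 (b a) (b c)) (fun a => contract (b.coord a) J) := by
  conv_lhs => rw [← sum_contract_coord_tmul b J]
  simp only [kappaField, map_sum, LinearMap.sum_apply, LinearMap.BilinForm.baseChange_tmul, quad]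
  rw [Finset.sum_comm]

theorem FieldAlgebra.coeff_contract [StarRing V] (A : FieldAlgebra V) (n : ℕ) (ξ χ : 𝔤 →ₗ[ℂ] ℂ)
    (J K : V ⊗[ℂ] 𝔤) : A.coeff n (contract ξ J) (contract χ K) =
      contract ((TensorProduct.lid ℂ ℂ).toLinearMap ∘ₗ TensorProduct.map ξ χ)
        (A.tensorCoeff n J K) := by
  induction J with
  | zero => simp [tensorCoeff]
  | add x y hx hy =>
    simp only [map_add, LinearMap.add_apply, hx, hy, tensorCoeff]
  | tmul f X =>
    induction K with
    | zero => simp [tensorCoeff]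
    | add x y hx hy =>
      rw [map_add, map_add, hx, hy, ← map_add]
      simp only [tensorCoeff, map_add]
    | tmul g Y =>
      simp [tensorCoeff, smul_smul, mul_comm]

theorem contract_casimirBracket {R : RealForm 𝔤} [DecidableEq ι] (B : DualBases 𝔤 R ι)
    (ξ χ : 𝔤 →ₗ[ℂ] ℂ) (J : V ⊗[ℂ] 𝔤) :
    contract ((TensorProduct.lid ℂ ℂ).toLinearMap ∘ₗ TensorProduct.map ξ χ)
      (casimirBracket B J) =
    ∑ c, χ (B.dual c) • contract (ξ ∘ₗ (LieAlgebra.ad ℂ 𝔤 (B.I c) : 𝔤 →ₗ[ℂ] 𝔤)) J := by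
  simp only [casimirBracket, map_sum, contract_lTensor]
  refine Finset.sum_congr rfl fun c _ => ?_
  induction J with
  | zero => simp
  | add x y hx hy => simp only [map_add, hx, hy, smul_add]
  | tmul f X => simp [smul_smul, mul_comm]

end Contraction

/-! ### Partial fractions and the twist function -/

section Takiff

variable {E : Type*} [AddCommGroup E] [Module ℂ E]

/-- Collecting the terms with `p + q = r` makes the coefficient of `f r` a two-variable geometric
sum, to be summed in closed form when `u ≠ v`. -/
theorem sum_truncated_eq (m : ℕ) (u v : ℂ) (f : ℕ → E) :
    (∑ p ∈ Finset.range m, ∑ q ∈ Finset.range m,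
      if p + q < m then (u ^ (p + 1) * v ^ (q + 1)) • f (p + q) else 0) =
    ∑ r ∈ Finset.range m, (u * v * ∑ p ∈ Finset.range (r + 1), u ^ p * v ^ (r - p)) • f r := by
  have h : ∀ r ∈ Finset.range m,
      (u * v * ∑ p ∈ Finset.range (r + 1), u ^ p * v ^ (r - p)) • f r =
      ∑ p ∈ Finset.range m, if p ≤ r then (u ^ (p + 1) * v ^ (r - p + 1)) • f r else 0 := by
    intro r hr
    rw [Finset.mem_range] at hr
    rw [Finset.mul_sum, Finset.sum_smul, ← Finset.sum_filter]
    refine Finset.sum_congr ?_ fun p _ => by congr 1; ring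
    ext p
    simp only [Finset.mem_range, Finset.mem_filter]
    omega
  rw [Finset.sum_congr rfl h]
  conv_rhs => rw [Finset.sum_comm]
  refine Finset.sum_congr rfl fun p hp => ?_
  rw [← Finset.sum_filter, ← Finset.sum_filter]
  refine Finset.sum_bij' (fun q _ => p + q) (fun r _ => r - p) ?_ ?_ ?_ ?_ ?_ <;>
    simp only [Finset.mem_filter, Finset.mem_range]
  · omega
  · omega
  · omega
  · omega
  · intro q _
    rw [Nat.add_sub_cancel_left]

namespace GaudinData

variable {Sr Sc : Type*} (G : GaudinData Sr Sc) [Fintype Sr] [Fintype Sc]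

/-- The rational function `∑ f^α_p / (z - z_α)^(p + 1)`. -/
def polar (f : Site Sr Sc → ℕ → E) (z : ℂ) : E :=
  ∑ α : Site Sr Sc, ∑ p ∈ Finset.range (G.mult α), (1 / (z - G.pos α) ^ (p + 1)) • f α p

/-- The sum `∑ f^α_(p + q) / ((w - z_α)^(p + 1) (z - z_α)^(q + 1))` over `p + q < m_α`. -/
def polarPair (f : Site Sr Sc → ℕ → E) (w z : ℂ) : E :=
  ∑ α : Site Sr Sc, ∑ p ∈ Finset.range (G.mult α), ∑ q ∈ Finset.range (G.mult α),
    if p + q < G.mult α then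
      (1 / (w - G.pos α) ^ (p + 1) * (1 / (z - G.pos α) ^ (q + 1))) • f α (p + q) else 0

theorem polarPair_eq (f : Site Sr Sc → ℕ → E) (w z : ℂ) :
    G.polarPair f w z = ∑ α : Site Sr Sc, ∑ r ∈ Finset.range (G.mult α),
      (1 / (w - G.pos α) * (1 / (z - G.pos α)) * ∑ p ∈ Finset.range (r + 1),
        (1 / (w - G.pos α)) ^ p * (1 / (z - G.pos α)) ^ (r - p)) • f α r := by
  simp only [polarPair, ← one_div_pow]
  exact Finset.sum_congr rfl fun α _ => sum_truncated_eq _ _ _ _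

/-- With `u = 1 / (w - z_α)` and `v = 1 / (z - z_α)` one has `(w - z) u v = v - u`, and this factor
telescopes the geometric sum to `v^(r+1) - u^(r+1)`. -/
theorem smul_polarPair (f : Site Sr Sc → ℕ → E) {w z : ℂ} (hw : ∀ α, w ≠ G.pos α)
    (hz : ∀ α, z ≠ G.pos α) :
    (w - z) • G.polarPair f w z = G.polar f z - G.polar f w := by
  simp only [polarPair_eq, polar, Finset.smul_sum, ← Finset.sum_sub_distrib, smul_smul, ← sub_smul]
  refine Finset.sum_congr rfl fun α _ => Finset.sum_congr rfl fun r _ => ?_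
  congr 1
  have h1 : w - G.pos α ≠ 0 := sub_ne_zero.mpr (hw α)
  have h2 : z - G.pos α ≠ 0 := sub_ne_zero.mpr (hz α)
  have h := geom_sum₂_mul (1 / (w - G.pos α)) (1 / (z - G.pos α)) (r + 1)
  simp only [Nat.add_sub_cancel] at h
  have h3 : (w - z) * (1 / (w - G.pos α) * (1 / (z - G.pos α)))
      = -(1 / (w - G.pos α) - 1 / (z - G.pos α)) := by
    field_simp; ring
  rw [← mul_assoc, h3, ← one_div_pow, ← one_div_pow, neg_mul, mul_comm, h]
  ring

theorem twist_eq_polar (z : ℂ) : G.twist z = G.polar G.level z - G.levelInf := by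
  simp only [twist, polar, smul_eq_mul, div_eq_mul_inv, one_mul]
  congr 1
  exact Finset.sum_congr rfl fun α _ => Finset.sum_congr rfl fun p _ => mul_comm _ _

theorem hasDerivAt_twist {w : ℂ} (hw : ∀ α, w ≠ G.pos α) :
    HasDerivAt G.twist (-G.polarPair G.level w w) w := by
  have hfun : G.twist = fun z => (∑ α : Site Sr Sc, ∑ p ∈ Finset.range (G.mult α),
      G.level α p * ((z - G.pos α) ^ (p + 1))⁻¹) - (G.levelInf : ℂ) := by
    funext z
    simp only [twist, div_eq_mul_inv]
  rw [hfun, polarPair_eq, ← Finset.sum_neg_distrib]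
  refine HasDerivAt.sub_const _ (HasDerivAt.fun_sum fun α _ => ?_)
  rw [← Finset.sum_neg_distrib]
  refine HasDerivAt.fun_sum fun p _ => ?_
  have h1 : w - G.pos α ≠ 0 := sub_ne_zero.mpr (hw α)
  have h := ((((hasDerivAt_id w).sub_const (G.pos α)).fun_pow (p + 1)).fun_inv
    (pow_ne_zero _ h1)).const_mul (G.level α p)
  -- On the diagonal all `p + 1` terms of the geometric sum agree, which reproduces the exponent
  -- brought down by differentiation.
  have h2 : ∑ k ∈ Finset.range (p + 1), (1 / (w - G.pos α)) ^ k * (1 / (w - G.pos α)) ^ (p - k)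
      = (p + 1) * (1 / (w - G.pos α)) ^ p := by
    rw [Finset.sum_congr rfl (g := fun _ => (1 / (w - G.pos α)) ^ p)]
    · simp
    · intro k hk
      rw [← pow_add]; congr 1
      have := Finset.mem_range.mp hk
      omega
  refine h.congr_deriv ?_
  rw [h2]
  simp only [id, smul_eq_mul, Nat.add_sub_cancel]
  push_cast
  rw [one_div, inv_pow]
  field_simp
  ring

theorem deriv_twist {w : ℂ} (hw : ∀ α, w ≠ G.pos α) :
    deriv G.twist w = -G.polarPair G.level w w :=
  (G.hasDerivAt_twist hw).deriv

theorem polarPair_level_eq_zero {w z : ℂ} (hw : ∀ α, w ≠ G.pos α) (hz : ∀ α, z ≠ G.pos α)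
    (hwz : w ≠ z) (h : G.twist w = G.twist z) : G.polarPair G.level w z = 0 := by
  have h1 := G.smul_polarPair G.level hw hz
  rw [G.twist_eq_polar, G.twist_eq_polar, sub_left_inj] at h
  rw [h, sub_self] at h1
  exact (smul_eq_zero_iff_right (sub_ne_zero.mpr hwz)).mp h1

end GaudinData

end Takiff

/-! ### Invariance of `κ` and brackets of the fields `κ(J, J)` -/

section Bracket

variable {𝔤 : Type*} [LieRing 𝔤] [LieAlgebra ℂ 𝔤]

theorem kappa_comm (x y : 𝔤) : kappa 𝔤 x y = kappa 𝔤 y x := by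
  simp only [kappa, LinearMap.neg_apply]
  rw [LieModule.traceForm_comm]

theorem kappa_lie_left (x y z : 𝔤) : kappa 𝔤 ⁅x, y⁆ z = kappa 𝔤 x ⁅y, z⁆ := by
  simp only [kappa, LinearMap.neg_apply]
  rw [LieModule.traceForm_apply_lie_apply]

/-- This and the next two lemmas say that the trilinear form `κ(x, [y, z])` is alternating; each
transposition kills `tripleField` when the corresponding two fields coincide. -/
theorem kappa_lie_swap_left (x y z : 𝔤) : kappa 𝔤 x ⁅y, z⁆ = -kappa 𝔤 y ⁅x, z⁆ := by
  rw [← kappa_lie_left, ← kappa_lie_left, ← lie_skew x y, map_neg, LinearMap.neg_apply]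

theorem kappa_lie_swap_outer (x y z : 𝔤) : kappa 𝔤 x ⁅y, z⁆ = -kappa 𝔤 z ⁅y, x⁆ := by
  rw [← kappa_lie_left, kappa_comm, ← lie_skew, map_neg]

theorem kappa_lie_swap_right (x y z : 𝔤) : kappa 𝔤 x ⁅y, z⁆ = -kappa 𝔤 x ⁅z, y⁆ := by
  rw [← lie_skew, map_neg]

variable {V : Type*} [CommRing V] [Algebra ℂ V] {ι : Type*} [Fintype ι]

/-- The field `κ(J, [K, L])`, in terms of the components of `J` and `K`. -/
def tripleField (b : Module.Basis ι ℂ 𝔤) (J K : V ⊗[ℂ] 𝔤) : V ⊗[ℂ] 𝔤 →ₗ[ℂ] V :=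
  ∑ c, ∑ e, LinearMap.mulLeft ℂ (contract (b.coord c) K * contract (b.coord e) J) ∘ₗ
    contract (kappa 𝔤 (b e) ∘ₗ (LieAlgebra.ad ℂ 𝔤 (b c) : 𝔤 →ₗ[ℂ] 𝔤))

theorem tripleField_apply (b : Module.Basis ι ℂ 𝔤) (J K L : V ⊗[ℂ] 𝔤) :
    tripleField b J K L = ∑ c, ∑ e, contract (b.coord c) K * contract (b.coord e) J *
      contract (kappa 𝔤 (b e) ∘ₗ (LieAlgebra.ad ℂ 𝔤 (b c) : 𝔤 →ₗ[ℂ] 𝔤)) L := by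
  simp [tripleField, LinearMap.sum_apply, mul_assoc]

theorem tripleField_apply' (b : Module.Basis ι ℂ 𝔤) (J K L : V ⊗[ℂ] 𝔤) :
    tripleField b J K L = ∑ c, ∑ e, ∑ d, kappa 𝔤 (b e) ⁅b c, b d⁆ •
      (contract (b.coord c) K * contract (b.coord e) J * contract (b.coord d) L) := by
  rw [tripleField_apply]
  refine Finset.sum_congr rfl fun c _ => Finset.sum_congr rfl fun e _ => ?_
  rw [contract_eq_sum b (kappa 𝔤 (b e) ∘ₗ _), Finset.mul_sum]
  simp

theorem tripleField_self_left (b : Module.Basis ι ℂ 𝔤) (J L : V ⊗[ℂ] 𝔤) :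
    tripleField b J J L = 0 := by
  rw [tripleField_apply']
  refine sum_sum_eq_zero_of_antisymm fun c e => ?_
  rw [← Finset.sum_neg_distrib]
  refine Finset.sum_congr rfl fun d _ => ?_
  rw [kappa_lie_swap_left, neg_smul, mul_comm (contract (b.coord c) J)]

theorem tripleField_self_outer (b : Module.Basis ι ℂ 𝔤) (J K : V ⊗[ℂ] 𝔤) :
    tripleField b J K J = 0 := by
  rw [tripleField_apply']
  refine Finset.sum_eq_zero fun c _ => sum_sum_eq_zero_of_antisymm fun e d => ?_
  rw [kappa_lie_swap_outer, neg_smul, mul_right_comm]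

theorem tripleField_self_right (b : Module.Basis ι ℂ 𝔤) (J K : V ⊗[ℂ] 𝔤) :
    tripleField b J K K = 0 := by
  rw [tripleField_apply', Finset.sum_comm]
  refine Finset.sum_eq_zero fun e _ => sum_sum_eq_zero_of_antisymm fun c d => ?_
  rw [kappa_lie_swap_right, neg_smul]
  congr 2; ring

variable {R : RealForm 𝔤} [DecidableEq ι] (B : DualBases 𝔤 R ι)

/-- Expanding `I^c` in the basis `I_b` turns duality into the statement that its coordinates invert
the Gram matrix of `κ`. -/
theorem DualBases.sum_kappa_mul_repr_dual (a c : ι) :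
    ∑ b, kappa 𝔤 (B.I a) (B.I b) * B.I.coord b (B.dual c) = if a = c then 1 else 0 := by
  rw [← B.kappa_dual a c]
  conv_rhs => rw [← B.I.sum_repr (B.dual c), map_sum]
  simp only [map_smul, smul_eq_mul, Module.Basis.coord_apply, mul_comm]

/-- `casimirBracket` as a linear map. -/
def casimirBracketHom : V ⊗[ℂ] 𝔤 →ₗ[ℂ] V ⊗[ℂ] (𝔤 ⊗[ℂ] 𝔤) :=
  ∑ a : ι, LinearMap.lTensor V
    ((TensorProduct.mk ℂ 𝔤 𝔤).flip (B.dual a) ∘ₗ (LieAlgebra.ad ℂ 𝔤 (B.I a) : 𝔤 →ₗ[ℂ] 𝔤))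

theorem casimirBracketHom_apply (J : V ⊗[ℂ] 𝔤) :
    casimirBracketHom B J = casimirBracket B J := by
  simp [casimirBracketHom, casimirBracket, LinearMap.sum_apply]

/-- The bracket of two quadratic fields `κ(J, J)` and `κ(K, K)` when
`{J_1(x), K_2(y)} = [C_12, L_1(x)] δ - s C_12 δ'`. -/
theorem FieldAlgebra.prod_kappaField [StarRing V] (A : FieldAlgebra V) {J K L : V ⊗[ℂ] 𝔤} {s : ℂ}
    (h0 : A.tensorCoeff 0 J K = casimirBracket B L)
    (h1 : A.tensorCoeff 1 J K = -(s • ((1 : V) ⊗ₜ[ℂ] casimir B)))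
    (h2 : ∀ n, 2 ≤ n → A.tensorCoeff n J K = 0) :
    A.prod 0 (kappaField J J) (kappaField K K) =
      (4 : ℂ) • (s • (∑ c, ∑ e, kappa 𝔤 (B.I c) (B.I e) •
        (contract (B.I.coord c) K * A.D (contract (B.I.coord e) J))) + tripleField B.I J K L) ∧
    A.prod 1 (kappaField J J) (kappaField K K) =
      (4 * s) • ∑ c, ∑ e, kappa 𝔤 (B.I c) (B.I e) •
        (contract (B.I.coord c) K * contract (B.I.coord e) J) ∧
    ∀ n, 2 ≤ n → A.prod n (kappaField J J) (kappaField K K) = 0 := by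
  have key := prod_quad_quad A (k := fun a c => kappa 𝔤 (B.I a) (B.I c))
    (m := fun c b => B.I.coord b (B.dual c)) (fun a b => kappa_comm _ _)
    B.sum_kappa_mul_repr_dual (u := fun a => contract (B.I.coord a) J)
    (v := fun a => contract (B.I.coord a) K) (s := s)
    -- The minus sign is that of `prod 0 g f = -coeff 0 f g`.
    (t := fun c a =>
      -contract (B.I.coord a ∘ₗ (LieAlgebra.ad ℂ 𝔤 (B.I c) : 𝔤 →ₗ[ℂ] 𝔤)) L)
    ?_ ?_ ?_
  · rw [kappaField_self_eq_quad B.I J, kappaField_self_eq_quad B.I K]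
    refine ⟨?_, key.2⟩
    rw [key.1, sub_eq_add_neg, tripleField_apply]
    congr 2
    simp only [← Finset.sum_neg_distrib, smul_neg]
    refine Finset.sum_congr rfl fun c _ => Finset.sum_congr rfl fun e _ => ?_
    rw [Finset.sum_neg_distrib, mul_neg, neg_neg, contract_eq_sum B.I (kappa 𝔤 (B.I e) ∘ₗ _)]
    simp only [contract_eq_sum B.I (B.I.coord _ ∘ₗ _)]
    congr 1
    simp only [Finset.smul_sum, smul_smul]
    rw [Finset.sum_comm]
    refine Finset.sum_congr rfl fun d _ => ?_
    rw [← Finset.sum_smul]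
    congr 1
    simp only [LinearMap.comp_apply]
    conv_rhs => rw [← B.I.sum_repr ((LieAlgebra.ad ℂ 𝔤 (B.I c) : 𝔤 →ₗ[ℂ] 𝔤) (B.I d)), map_sum]
    simp only [map_smul, smul_eq_mul, Module.Basis.coord_apply, mul_comm]
  · intro a b
    rw [A.prod_eq_smul_coeff, A.coeff_contract, h0, contract_casimirBracket]
    simp
  · intro a b
    rw [A.prod_eq_smul_coeff, A.coeff_contract, h1]
    simp only [casimir, map_neg, map_smul, contract_tmul]
    simp [Finsupp.single_apply, smul_smul]
  · intro n hn a b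
    rw [A.prod_eq_smul_coeff, A.coeff_contract, h2 n hn]
    simp

omit [DecidableEq ι] in
theorem FieldAlgebra.D_kappaField [StarRing V] (A : FieldAlgebra V) (b : Module.Basis ι ℂ 𝔤)
    (J : V ⊗[ℂ] 𝔤) : A.D (kappaField J J) = (2 : ℂ) • ∑ c, ∑ e, kappa 𝔤 (b c) (b e) •
      (contract (b.coord c) J * A.D (contract (b.coord e) J)) := by
  rw [kappaField_self_eq_quad b, Derivation.map_quad _ fun _ _ => kappa_comm _ _]

end Bracket

/-! ### Brackets of the Lax matrix and of the densities `q_i` -/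

namespace GaudinData

variable {𝔤 : Type*} [LieRing 𝔤] [LieAlgebra ℂ 𝔤] {V : Type*} [CommRing V] [Algebra ℂ V]
  [StarRing V] [StarModule ℂ V] {R : RealForm 𝔤} {ι : Type*} [Fintype ι] [DecidableEq ι]
  {B : DualBases 𝔤 R ι} {A : FieldAlgebra V} {Sr Sc : Type*} [Fintype Sr] [Fintype Sc]
  {G : GaudinData Sr Sc} {J : Site Sr Sc → ℕ → V ⊗[ℂ] 𝔤}

omit [StarModule ℂ V] in
-- Takiff brackets are diagonal in the sites and depend on `p`, `q` only through `p + q`, with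
-- truncation at `m_α`; this is exactly the summation pattern of `polarPair`.
theorem tensorCoeff_lax (n : ℕ) (w z : ℂ) {E : Site Sr Sc → ℕ → V ⊗[ℂ] (𝔤 ⊗[ℂ] 𝔤)}
    (h : ∀ α β p q, p < G.mult α → q < G.mult β → A.tensorCoeff n (J α p) (J β q) =
      open Classical in if α = β ∧ p + q < G.mult α then E α (p + q) else 0) :
    A.tensorCoeff n (G.lax J w) (G.lax J z) = G.polarPair E w z := by
  classical
  simp only [FieldAlgebra.tensorCoeff, lax, map_sum, LinearMap.sum_apply, map_smul,
    LinearMap.smul_apply, polarPair] at h ⊢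
  refine Finset.sum_congr rfl fun α _ => ?_
  conv_rhs => rw [Finset.sum_comm]
  refine Finset.sum_congr rfl fun q hq => ?_
  rw [Finset.sum_eq_single α]
  · rw [Finset.smul_sum]
    refine Finset.sum_congr rfl fun p hp => ?_
    rw [h α α p q (Finset.mem_range.mp hp) (Finset.mem_range.mp hq)]
    simp [smul_smul, mul_comm]
  · intro β _ hβ
    refine Finset.sum_eq_zero fun p hp => ?_
    rw [h β α p q (Finset.mem_range.mp hp) (Finset.mem_range.mp hq)]
    simp [hβ]
  · simp

theorem map_polarPair {E F : Type*} [AddCommGroup E] [Module ℂ E] [AddCommGroup F] [Module ℂ F]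
    (f : E →ₗ[ℂ] F) (x : Site Sr Sc → ℕ → E) (w z : ℂ) :
    f (G.polarPair x w z) = G.polarPair (fun α p => f (x α p)) w z := by
  simp only [polarPair, map_sum, apply_ite f, map_smul, map_zero]

theorem IsRealisation.tensorCoeff_zero_lax (hJ : G.IsRealisation A B J) (w z : ℂ) :
    A.tensorCoeff 0 (G.lax J w) (G.lax J z) = casimirBracket B (G.polarPair J w z) := by
  rw [tensorCoeff_lax 0 w z (E := fun α p => casimirBracket B (J α p)) hJ.bracket_zero,
    ← casimirBracketHom_apply, map_polarPair]
  simp only [casimirBracketHom_apply]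

theorem IsRealisation.tensorCoeff_one_lax (hJ : G.IsRealisation A B J) (w z : ℂ) :
    A.tensorCoeff 1 (G.lax J w) (G.lax J z) =
      -(G.polarPair G.level w z • ((1 : V) ⊗ₜ[ℂ] casimir B)) := by
  rw [tensorCoeff_lax 1 w z (E := fun α p => -(G.level α p • ((1 : V) ⊗ₜ[ℂ] casimir B)))
    hJ.bracket_one]
  have := map_polarPair (G := G) (-(LinearMap.toSpanSingleton ℂ _ ((1 : V) ⊗ₜ[ℂ] casimir B)))
    G.level w z
  simpa using this.symm

theorem IsRealisation.tensorCoeff_high_lax (hJ : G.IsRealisation A B J) (w z : ℂ) (n : ℕ)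
    (hn : 2 ≤ n) : A.tensorCoeff n (G.lax J w) (G.lax J z) = 0 := by
  rw [tensorCoeff_lax n w z (E := 0) fun α β p q hp hq => by
    simp [hJ.bracket_high α β p q n hp hq hn]]
  simp [polarPair]

theorem IsRealisation.prod_kappaField_lax_of_ne (hJ : G.IsRealisation A B J) {w z : ℂ}
    (hw : ∀ α, w ≠ G.pos α) (hz : ∀ α, z ≠ G.pos α) (hwz : w ≠ z)
    (h : G.twist w = G.twist z) (n : ℕ) :
    A.prod n (kappaField (G.lax J w) (G.lax J w)) (kappaField (G.lax J z) (G.lax J z)) = 0 := by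
  have key := A.prod_kappaField B (hJ.tensorCoeff_zero_lax w z) (hJ.tensorCoeff_one_lax w z)
    (hJ.tensorCoeff_high_lax w z)
  rw [G.polarPair_level_eq_zero hw hz hwz h] at key
  match n with
  | 0 =>
    -- After multiplication by `w - z ≠ 0` the last argument becomes `Γ(z) - Γ(w)`, and each term
    -- repeats one of the first two arguments.
    have h3 : tripleField B.I (G.lax J w) (G.lax J z) (G.polarPair J w z) = 0 := by
      have h4 := congrArg (tripleField B.I (G.lax J w) (G.lax J z)) (G.smul_polarPair J hw hz)
      have h5 : ∀ x, G.polar J x = G.lax J x := fun x => rfl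
      rw [map_smul, map_sub, h5, h5, tripleField_self_right, tripleField_self_outer, sub_zero] at h4
      exact (smul_eq_zero_iff_right (sub_ne_zero.mpr hwz)).mp h4
    rw [key.1, h3]
    simp
  | 1 => rw [key.2.1]; simp
  | n + 2 => exact key.2.2 _ (by omega)

theorem IsRealisation.prod_kappaField_lax_self (hJ : G.IsRealisation A B J) {w : ℂ}
    (hw : ∀ α, w ≠ G.pos α) :
    A.prod 0 (kappaField (G.lax J w) (G.lax J w)) (kappaField (G.lax J w) (G.lax J w)) =
      -((2 * deriv G.twist w) • A.D (kappaField (G.lax J w) (G.lax J w))) ∧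
    A.prod 1 (kappaField (G.lax J w) (G.lax J w)) (kappaField (G.lax J w) (G.lax J w)) =
      -((4 * deriv G.twist w) • kappaField (G.lax J w) (G.lax J w)) ∧
    ∀ n, 2 ≤ n →
      A.prod n (kappaField (G.lax J w) (G.lax J w)) (kappaField (G.lax J w) (G.lax J w)) = 0 := by
  have key := A.prod_kappaField B (hJ.tensorCoeff_zero_lax w w) (hJ.tensorCoeff_one_lax w w)
    (hJ.tensorCoeff_high_lax w w)
  refine ⟨?_, ?_, key.2.2⟩
  · rw [key.1, tripleField_self_left, add_zero, G.deriv_twist hw, A.D_kappaField B.I, smul_smul,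
      smul_smul, ← neg_smul]
    congr 1; ring
  · rw [key.2.1, G.deriv_twist hw, ← neg_smul]
    conv_rhs => rw [kappaField_self_eq_quad B.I]
    rw [quad]
    congr 1; ring

variable {ζ : Fin G.numZeros → ℂ}

theorem IsSimpleZeros.ne_pos (hζ : G.IsSimpleZeros ζ) (i : Fin G.numZeros) (α : Site Sr Sc) :
    ζ i ≠ G.pos α :=
  ((hζ.mem_iff (ζ i)).mp ⟨i, rfl⟩).1 α

theorem IsSimpleZeros.twist_eq_zero (hζ : G.IsSimpleZeros ζ) (i : Fin G.numZeros) :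
    G.twist (ζ i) = 0 :=
  ((hζ.mem_iff (ζ i)).mp ⟨i, rfl⟩).2

theorem IsRealisation.prod_chargeDensity_of_ne (hJ : G.IsRealisation A B J)
    (hζ : G.IsSimpleZeros ζ) {i j : Fin G.numZeros} (hij : i ≠ j) (n : ℕ) :
    A.prod n (G.chargeDensity J (ζ i)) (G.chargeDensity J (ζ j)) = 0 := by
  simp only [chargeDensity, map_smul, LinearMap.smul_apply]
  rw [hJ.prod_kappaField_lax_of_ne (hζ.ne_pos i) (hζ.ne_pos j) (hζ.injective.ne hij)
    (by rw [hζ.twist_eq_zero, hζ.twist_eq_zero])]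
  simp

theorem IsRealisation.prod_chargeDensity_self (hJ : G.IsRealisation A B J)
    (hζ : G.IsSimpleZeros ζ) (i : Fin G.numZeros) :
    A.prod 0 (G.chargeDensity J (ζ i)) (G.chargeDensity J (ζ i)) =
      A.D (G.chargeDensity J (ζ i)) ∧
    A.prod 1 (G.chargeDensity J (ζ i)) (G.chargeDensity J (ζ i)) =
      (2 : ℂ) • G.chargeDensity J (ζ i) ∧
    ∀ n, 2 ≤ n → A.prod n (G.chargeDensity J (ζ i)) (G.chargeDensity J (ζ i)) = 0 := by
  have h := hζ.simple i
  obtain ⟨h0, h1, h2⟩ := hJ.prod_kappaField_lax_self (hζ.ne_pos i)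
  simp only [chargeDensity, map_smul, LinearMap.smul_apply, Derivation.map_smul]
  refine ⟨?_, ?_, fun n hn => by rw [h2 n hn]; simp⟩
  · rw [h0, ← neg_smul, smul_smul, smul_smul]
    congr 1; field_simp
  · rw [h1, ← neg_smul, smul_smul, smul_smul, smul_smul]
    congr 1; field_simp; norm_num


/-! ### The residue identity and the momentum -/

section Momentum

variable {Sr Sc : Type*} (G : GaudinData Sr Sc)

/-- The labels `(α, p)`, `p < m_α`, of the Takiff currents. -/
abbrev CurrentIndex : Type _ := Σ α : Site Sr Sc, Fin (G.mult α)

open Classical in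
/-- The matrix of the levels `ℓ^α_(p + q)`. -/
def levelMatrix : Matrix G.CurrentIndex G.CurrentIndex ℂ :=
  fun x y => if x.1 = y.1 ∧ (x.2 : ℕ) + y.2 < G.mult x.1 then G.level x.1 (x.2 + y.2) else 0

open Classical in
/-- The matrix of the numbers `η^α_(p + q)`. -/
def dualLevelMatrix (η : Site Sr Sc → ℕ → ℂ) : Matrix G.CurrentIndex G.CurrentIndex ℂ :=
  fun x y => if x.1 = y.1 then η x.1 (x.2 + y.2) else 0

variable [Fintype Sr] [Fintype Sc]

/-- The matrix of the numbers `1 / (ζ_i - z_α)^(p + 1)`. -/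
def poleMatrix (ζ : Fin G.numZeros → ℂ) : Matrix G.CurrentIndex (Fin G.numZeros) ℂ :=
  fun x i => 1 / (ζ i - G.pos x.1) ^ ((x.2 : ℕ) + 1)

variable {G} {η : Site Sr Sc → ℕ → ℂ} {ζ : Fin G.numZeros → ℂ}

open Classical in
theorem IsDualLevels.dualLevelMatrix_mul_levelMatrix (hη : G.IsDualLevels η) :
    G.dualLevelMatrix η * G.levelMatrix = 1 := by
  ext ⟨α, q⟩ ⟨β, r⟩
  rw [Matrix.mul_apply, Fintype.sum_sigma, Finset.sum_eq_single α]
  · by_cases hαβ : α = β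
    · subst hαβ
      have h := hη α q r q.2 r.2
      -- The range `p < m_α - r` of the duality relation is traded for `p < m_α` with the truncation
      -- `p + r < m_α` of the level matrix.
      rw [Finset.sum_congr rfl (g := fun p => if p + (r : ℕ) < G.mult α then
        η α (q + p) * G.level α (p + r) else 0) fun p hp => by
          rw [if_pos (by have := Finset.mem_range.mp hp; omega), add_comm p (q : ℕ)],
        Finset.sum_subset (s₂ := Finset.range (G.mult α))
          (Finset.range_subset_range.mpr (Nat.sub_le _ _)) fun p _ hp => by
            rw [if_neg (by simp at hp; omega)], Finset.sum_range] at h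
      simpa [dualLevelMatrix, levelMatrix, Matrix.one_apply, Fin.ext_iff] using h
    · rw [Matrix.one_apply_ne (by simp [hαβ])]
      simp [levelMatrix, hαβ]
  · intro γ _ hγ
    simp [dualLevelMatrix, hγ.symm]
  · simp

theorem poleMatrix_transpose_mul_levelMatrix_mul (i j : Fin G.numZeros) :
    ((G.poleMatrix ζ).transpose * (G.levelMatrix * G.poleMatrix ζ)) i j =
      G.polarPair G.level (ζ i) (ζ j) := by
  classical
  rw [Matrix.mul_apply, Fintype.sum_sigma, polarPair]
  refine Finset.sum_congr rfl fun α _ => ?_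
  rw [Finset.sum_range]
  refine Finset.sum_congr rfl fun p _ => ?_
  rw [Matrix.mul_apply, Fintype.sum_sigma, Finset.sum_eq_single α, Finset.sum_range,
    Finset.mul_sum]
  · refine Finset.sum_congr rfl fun q _ => ?_
    simp only [Matrix.transpose_apply, poleMatrix, levelMatrix, true_and, smul_eq_mul]
    split_ifs
    · ring
    · ring
  · intro β _ hβ
    simp [levelMatrix, hβ.symm]
  · simp

open Classical in
/-- The residue identity
`-∑_i 1 / (φ'(ζ_i) (ζ_i - z_α)^(p + 1) (ζ_i - z_β)^(q + 1)) = δ_αβ η^α_(p + q)`. -/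
theorem IsSimpleZeros.poleMatrix_mul_diagonal_mul (hζ : G.IsSimpleZeros ζ)
    (hη : G.IsDualLevels η) :
    G.poleMatrix ζ * (Matrix.diagonal (fun i => -(deriv G.twist (ζ i))⁻¹) *
      (G.poleMatrix ζ).transpose) = G.dualLevelMatrix η := by
  have h1 : (G.poleMatrix ζ).transpose * (G.levelMatrix * G.poleMatrix ζ) =
      Matrix.diagonal (fun i => -deriv G.twist (ζ i)) := by
    ext i j
    rw [poleMatrix_transpose_mul_levelMatrix_mul]
    by_cases hij : i = j
    · subst hij
      rw [Matrix.diagonal_apply_eq, G.deriv_twist (hζ.ne_pos i), neg_neg]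
    · rw [Matrix.diagonal_apply_ne _ hij]
      exact G.polarPair_level_eq_zero (hζ.ne_pos i) (hζ.ne_pos j) (hζ.injective.ne hij)
        (by rw [hζ.twist_eq_zero, hζ.twist_eq_zero])
  have h2 : (Matrix.diagonal (fun i => -(deriv G.twist (ζ i))⁻¹) *
      (G.poleMatrix ζ).transpose) * (G.levelMatrix * G.poleMatrix ζ) = 1 := by
    rw [Matrix.mul_assoc, h1, Matrix.diagonal_mul_diagonal, ← Matrix.diagonal_one]
    congr 1
    funext i
    simp [hζ.simple i]
  have hcard : Fintype.card (Fin G.numZeros) = Fintype.card G.CurrentIndex := by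
    simp [numZeros, CurrentIndex, Fintype.card_sigma]
  -- There are as many zeros as currents, so a one-sided inverse is two-sided. This inverts the
  -- diagonalisation `h1` and takes the place of a residue computation.
  have h3 := (Matrix.mul_eq_one_comm_of_card_eq _ _ _ hcard).mp h2
  rw [Matrix.mul_assoc] at h3
  rw [← Matrix.one_mul (G.poleMatrix ζ * _), ← hη.dualLevelMatrix_mul_levelMatrix,
    Matrix.mul_assoc, h3, Matrix.mul_one]

variable {𝔤 : Type*} [LieRing 𝔤] [LieAlgebra ℂ 𝔤] {V : Type*} [CommRing V] [Algebra ℂ V]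

theorem lax_eq_sum_poleMatrix (J : Site Sr Sc → ℕ → V ⊗[ℂ] 𝔤) (i : Fin G.numZeros) :
    G.lax J (ζ i) = ∑ x : G.CurrentIndex, G.poleMatrix ζ x i • J x.1 x.2 := by
  rw [lax, Fintype.sum_sigma]
  refine Finset.sum_congr rfl fun α _ => ?_
  rw [Finset.sum_range]
  rfl

/-- Both sides are quadratic in the currents, and the residue identity matches their coefficients;
the densities agree exactly, not merely modulo `∂_x`. -/
theorem IsSimpleZeros.sum_chargeDensity (hζ : G.IsSimpleZeros ζ) (hη : G.IsDualLevels η)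
    (J : Site Sr Sc → ℕ → V ⊗[ℂ] 𝔤) :
    ∑ i, G.chargeDensity J (ζ i) = ∑ α, G.segalSugawara η J α 0 := by
  classical
  have hl : ∀ i, G.chargeDensity J (ζ i) = ∑ x : G.CurrentIndex, ∑ y : G.CurrentIndex,
      ((1 / 2 : ℂ) * (G.poleMatrix ζ x i * (-(deriv G.twist (ζ i))⁻¹ * G.poleMatrix ζ y i))) •
        kappaField (J x.1 x.2) (J y.1 y.2) := by
    intro i
    rw [chargeDensity, lax_eq_sum_poleMatrix]
    simp only [map_sum, LinearMap.sum_apply, LinearMap.map_smul_of_tower, LinearMap.smul_apply,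
      Finset.smul_sum, smul_smul]
    rw [Finset.sum_comm]
    refine Finset.sum_congr rfl fun x _ => Finset.sum_congr rfl fun y _ => ?_
    congr 1
    rw [one_div, mul_inv]
    ring
  have hr : ∀ α, G.segalSugawara η J α 0 = ∑ p : Fin (G.mult α), ∑ y : G.CurrentIndex,
      ((1 / 2 : ℂ) * G.dualLevelMatrix η ⟨α, p⟩ y) • kappaField (J α p) (J y.1 y.2) := by
    intro α
    rw [segalSugawara, Finset.sum_range, Finset.smul_sum]
    refine Finset.sum_congr rfl fun p _ => ?_
    rw [Fintype.sum_sigma, Finset.sum_eq_single α, Finset.sum_range, Finset.smul_sum]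
    · refine Finset.sum_congr rfl fun r _ => ?_
      simp [dualLevelMatrix, smul_smul]
    · intro β _ hβ
      simp [dualLevelMatrix, hβ.symm]
    · simp
  simp only [hl, hr]
  rw [← Fintype.sum_sigma' (f := fun α p => ∑ y : G.CurrentIndex,
      ((1 / 2 : ℂ) * G.dualLevelMatrix η ⟨α, p⟩ y) • kappaField (J α p) (J y.1 y.2)),
    Finset.sum_comm]
  refine Finset.sum_congr rfl fun x _ => ?_
  rw [Finset.sum_comm]
  refine Finset.sum_congr rfl fun y _ => ?_
  rw [← Finset.sum_smul, ← Finset.mul_sum, ← hζ.poleMatrix_mul_diagonal_mul hη, Matrix.mul_apply]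
  simp only [Matrix.diagonal_mul, Matrix.transpose_apply]

end Momentum

end GaudinData

/-! ### Linear combinations of commuting densities and Lorentz boosts -/

namespace FieldAlgebra

variable {V : Type*} [CommRing V] [Algebra ℂ V] [StarRing V] (A : FieldAlgebra V)

theorem flow_integral (f : V) : A.flow (A.integral f) = A.mode 0 f := by
  simp only [flow, integral]
  exact Submodule.liftQ_apply _ _ _

theorem mode_apply (n : ℕ) (f g : V) : A.mode n f g = A.prod n f g := rfl

variable {A} {κ : Type*} [Fintype κ] {q : κ → V}

theorem prod_zero_sum [DecidableEq κ]
    (h : ∀ i j, A.prod 0 (q i) (q j) = if i = j then A.D (q i) else 0)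
    (ε ε' : κ → ℂ) : A.prod 0 (∑ i, ε i • q i) (∑ i, ε' i • q i) =
      ∑ i, (ε i * ε' i) • A.D (q i) := by
  simp only [map_sum, LinearMap.sum_apply, map_smul, LinearMap.smul_apply, h]
  simp [smul_smul, mul_comm]

theorem prod_one_sum [DecidableEq κ]
    (h : ∀ i j, A.prod 1 (q i) (q j) = if i = j then (2 : ℂ) • q i else 0)
    (ε ε' : κ → ℂ) : A.prod 1 (∑ i, ε i • q i) (∑ i, ε' i • q i) =
      (2 : ℂ) • ∑ i, (ε i * ε' i) • q i := by
  simp only [map_sum, LinearMap.sum_apply, map_smul, LinearMap.smul_apply, h, Finset.smul_sum]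
  simp only [smul_ite, smul_zero, smul_smul, Finset.sum_ite_eq', Finset.mem_univ, if_true]
  exact Finset.sum_congr rfl fun i _ => by congr 1; ring

/-- The model whose Hamiltonian has density `b` is Lorentz invariant if `b_(0) b = ∂ p` and
`b_(1) b = 2 p` for a density `p` of the momentum. -/
theorem isLorentzInvariant_of_prod_self {b p : V} {P : A.Charge} (hP : A.IsMomentum P)
    (hp : A.integral p = P) (h0 : A.prod 0 b b = A.D p) (h1 : A.prod 1 b b = (2 : ℂ) • p) :
    A.IsLorentzInvariant (A.integral b) P := by
  have hflow : A.flow P = A.D := Derivation.ext hP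
  refine ⟨b, rfl, ?_, ?_, ?_⟩
  · rw [hflow, flow_integral]
    ext f
    simp [Derivation.commutator_apply, mode_apply, A.deriv_right]
  · rw [hflow, flow_integral]
    ext f
    simp [Derivation.commutator_apply, mode_apply, A.deriv_right]
  · rw [← hp, flow_integral, flow_integral]
    ext f
    -- This reads `[b_(1), b_(0)] = (b_(0) b)_(1) + (b_(1) b)_(0) = (∂p)_(1) + 2 p_(0)`, and
    -- `(∂p)_(1) = -p_(0)`, which leaves the flow of `P`.
    have h := A.jacobi 1 0 b b f
    simp only [Finset.sum_range_succ, Finset.sum_range_zero, h0, h1, A.deriv_left] at h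
    rw [Derivation.commutator_apply, mode_apply, mode_apply, mode_apply, mode_apply, h, mode_apply]
    simp [two_smul]

end FieldAlgebra

end AffineGaudin

end

/-! ### The energy-momentum tensor and Lorentz invariance -/

theorem proposition2p4
    {𝔤 : Type*} [LieRing 𝔤] [LieAlgebra ℂ 𝔤] [FiniteDimensional ℂ 𝔤] [LieAlgebra.IsSimple ℂ 𝔤]
    (R : AffineGaudin.RealForm 𝔤)
    {ι : Type*} [Fintype ι] [DecidableEq ι] (B : AffineGaudin.DualBases 𝔤 R ι)
    {V : Type*} [CommRing V] [Algebra ℂ V] [StarRing V] [StarModule ℂ V]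
    (A : AffineGaudin.FieldAlgebra V) (P : A.Charge) (hP : A.IsMomentum P)
    {Sr Sc : Type*} [Fintype Sr] [Fintype Sc] (G : AffineGaudin.GaudinData Sr Sc)
    (hpos : Function.Injective G.pos)
    (J : AffineGaudin.Site Sr Sc → ℕ → TensorProduct ℂ V 𝔤) (hJ : G.IsRealisation A B J)
    (η : AffineGaudin.Site Sr Sc → ℕ → ℂ) (hη : G.IsDualLevels η)
    (hsuit : G.IsSuitable A η J P)
    (ζ : Fin G.numZeros → ℂ) (hζ : G.IsSimpleZeros ζ)
    (ε : Fin G.numZeros → ℂ)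
    (q : Fin G.numZeros → V) (hq : ∀ i, q i = G.chargeDensity J (ζ i))
    (H : A.Charge) (hH : H = G.hamiltonian A J ζ ε)
    (T : Fin 2 → Fin 2 → V)
    (hT01 : T 0 1 = ∑ i, q i) (hT00 : T 0 0 = ∑ i, ε i • q i)
    (hT11 : T 1 1 = -∑ i, ε i • q i) (hT10 : T 1 0 = -∑ i, ε i ^ 2 • q i) :
    -- the bracket `{q_i(x), q_j(y)} = -δ_{ij} (∂_x q_i(x) δ(x - y) + 2 q_i(x) δ'(x - y))`
    (∀ i j,
      A.coeff 0 (q i) (q j) = (if i = j then -A.D (q i) else 0) ∧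
      A.coeff 1 (q i) (q j) = (if i = j then -((2 : ℂ) • q i) else 0) ∧
      ∀ n, 2 ≤ n → A.coeff n (q i) (q j) = 0) ∧
    -- `T` is an energy-momentum tensor, and its components `T^1_ν` are, up to fields with vanishing
    -- space derivative, the only ones for these densities of `H` and `P`
    A.IsEnergyMomentumTensor H P T ∧
    (∀ T' : Fin 2 → Fin 2 → V, A.IsEnergyMomentumTensor H P T' → (∀ ν, T' 0 ν = T 0 ν) →
      ∀ ν, A.D (T' 1 ν - T 1 ν) = 0) ∧
    -- `T` is traceless
    ∑ μ, T μ μ = 0 ∧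
    -- symmetry of `T_{μν}` for `ε_i = ±1`, and Lorentz invariance
    ((∀ i, ε i = 1 ∨ ε i = -1) →
      ∀ μ ν, AffineGaudin.lowerIndex T μ ν = AffineGaudin.lowerIndex T ν μ) ∧
    ((∀ μ ν, AffineGaudin.lowerIndex T μ ν = AffineGaudin.lowerIndex T ν μ) →
      A.IsLorentzInvariant H P) ∧
    ((∀ i, ε i = 1 ∨ ε i = -1) → A.IsLorentzInvariant H P) := by
  classical
  obtain rfl : q = fun i => G.chargeDensity J (ζ i) := funext hq
  have hne : ∀ n i j, i ≠ j →
      A.prod n (G.chargeDensity J (ζ i)) (G.chargeDensity J (ζ j)) = 0 :=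
    fun n i j hij => hJ.prod_chargeDensity_of_ne hζ hij n
  have hself := hJ.prod_chargeDensity_self hζ
  set q : Fin G.numZeros → V := fun i => G.chargeDensity J (ζ i)
  have hp0 : ∀ i j, A.prod 0 (q i) (q j) = if i = j then A.D (q i) else 0 := by
    intro i j
    split_ifs with h
    · subst h; exact (hself i).1
    · exact hne 0 i j h
  have hp1 : ∀ i j, A.prod 1 (q i) (q j) = if i = j then (2 : ℂ) • q i else 0 := by
    intro i j
    split_ifs with h
    · subst h; exact (hself i).2.1
    · exact hne 1 i j h
  have hp2 : ∀ n, 2 ≤ n → ∀ i j, A.prod n (q i) (q j) = 0 := by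
    intro n hn i j
    by_cases h : i = j
    · subst h; exact (hself i).2.2 n hn
    · exact hne n i j h
  have hHT : A.integral (T 0 0) = H := by
    rw [hT00, hH, AffineGaudin.GaudinData.hamiltonian, map_sum]
    exact Finset.sum_congr rfl fun i _ => map_smul _ _ _
  have hPT : A.integral (T 0 1) = P := by
    rw [hT01, hζ.sum_chargeDensity hη J, map_sum]
    exact hsuit
  -- The momentum density is the combination with all coefficients `1`, so `prod_zero_sum` covers
  -- both conservation laws.
  have hone : ∑ i, q i = ∑ i, (1 : ℂ) • q i := by simp only [one_smul]
  have hcons : ∀ ν, A.spaceTimeDeriv H P 0 (T 0 ν) + A.D (T 1 ν) = 0 := by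
    intro ν
    have h : ∀ f, A.spaceTimeDeriv H P 0 f = A.prod 0 (∑ i, ε i • q i) f := by
      intro f
      rw [← hHT, hT00]
      simp only [AffineGaudin.FieldAlgebra.spaceTimeDeriv, Matrix.cons_val_zero,
        AffineGaudin.FieldAlgebra.flow_integral, AffineGaudin.FieldAlgebra.mode_apply]
    rw [h]
    fin_cases ν
    · simp only [Fin.zero_eta]
      rw [hT00, hT10, AffineGaudin.FieldAlgebra.prod_zero_sum hp0]
      simp [map_sum, sq]
    · simp only [Fin.mk_one]
      rw [hT01, hT11, hone, AffineGaudin.FieldAlgebra.prod_zero_sum hp0]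
      simp [map_sum]
  have hsum : ∀ (T' : Fin 2 → Fin 2 → V) (ν : Fin 2),
      ∑ μ, A.spaceTimeDeriv H P μ (T' μ ν) = A.spaceTimeDeriv H P 0 (T' 0 ν) + A.D (T' 1 ν) := by
    intro T' ν
    rw [Fin.sum_univ_two]
    congr 1
    exact hP _
  have hsymm : (∀ i, ε i = 1 ∨ ε i = -1) →
      ∀ μ ν, AffineGaudin.lowerIndex T μ ν = AffineGaudin.lowerIndex T ν μ := by
    intro hε
    have h01 : T 0 1 = -T 1 0 := by
      rw [hT01, hT10, neg_neg]
      refine Finset.sum_congr rfl fun i _ => ?_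
      rcases hε i with h | h <;> simp [h]
    intro μ ν
    fin_cases μ <;> fin_cases ν <;>
      simp [AffineGaudin.lowerIndex, AffineGaudin.minkowski, Matrix.diagonal_apply, h01]
  have hlor : (∀ μ ν, AffineGaudin.lowerIndex T μ ν = AffineGaudin.lowerIndex T ν μ) →
      A.IsLorentzInvariant H P := by
    intro hs
    -- Lowering with `diag(1, -1)` flips the sign of the row `μ = 1`, so the off-diagonal entry is
    -- the whole content of symmetry. It is used only as `∑ ε_i² q_i = ∑ q_i`; no condition on the
    -- individual `ε_i` is needed.
    have h01 : T 0 1 = -T 1 0 := by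
      simpa [AffineGaudin.lowerIndex, AffineGaudin.minkowski, Matrix.diagonal_apply] using hs 0 1
    have hsq : ∑ i, (ε i * ε i) • q i = T 0 1 := by
      rw [h01, hT10, neg_neg]
      exact Finset.sum_congr rfl fun i _ => by rw [sq]
    rw [← hHT]
    refine AffineGaudin.FieldAlgebra.isLorentzInvariant_of_prod_self hP hPT ?_ ?_
    · rw [hT00, AffineGaudin.FieldAlgebra.prod_zero_sum hp0, ← hsq]
      simp [map_sum]
    · rw [hT00, AffineGaudin.FieldAlgebra.prod_one_sum hp1, ← hsq]
  refine ⟨fun i j => ⟨?_, ?_, fun n hn => ?_⟩, ⟨hHT, hPT, fun ν => ?_⟩, ?_, ?_, hsymm, hlor,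
    fun hε => hlor (hsymm hε)⟩
  · simp only [AffineGaudin.FieldAlgebra.coeff, LinearMap.smul_apply, LinearMap.flip_apply, hp0]
    by_cases h : i = j
    · subst h; simp
    · simp [h, Ne.symm h]
  · simp only [AffineGaudin.FieldAlgebra.coeff, LinearMap.smul_apply, LinearMap.flip_apply, hp1]
    by_cases h : i = j
    · subst h; simp
    · simp [h, Ne.symm h]
  · simp [AffineGaudin.FieldAlgebra.coeff, hp2 n hn]
  · rw [hsum, hcons]
  · intro T' hT' h0 ν
    -- The density `T^0_ν` being fixed, conservation determines `∂_x T^1_ν`.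
    have h := hT'.conservation ν
    rw [hsum, h0, ← hcons ν] at h
    rw [map_sub, add_left_cancel h, sub_self]
  · rw [Fin.sum_univ_two, hT00, hT11, add_neg_cancel]
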